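/- Let $A$ and $B$ be (complex, not necessarily unital) $C^*$-algebras and let $\varphi\colon A\to B$ be a bounded, linear map. We say that $\varphi$ preserves - zero-products if $ab=0$ implies $\varphi(a)\varphi(b)=0$ for all $a,b\in A$; - range-orthogonality if $a^*b=0$ implies $\varphi(a)^*\varphi(b)=0$ for all $a,b\in A$; - domain-orthogonality if $ab^*=0$ implies $\varphi(a)\varphi(b)^*=0$ for all $a,b\in A$; - zero-TRO-products if $ab^*c=0$ implies $\varphi(a)\varphi(b)^*\varphi(c)=0$ for all $a,b,c\in A$. Then: 1. $\varphi$ preserves zero-products if and only if $\varphi(ab)\varphi(c)=\varphi(a)\varphi(bc)$ for all $a,b,c\in A$. 2. $\varphi$ preserves range-orthogonality if and only if $\varphi(b^*a)^*\varphi(c)=\varphi(a)^*\varphi(bc)$ for all $a,b,c\in A$. 3. $\varphi$ preserves domain-orthogonality if and only if $\varphi(ab)\varphi(c)^*=\varphi(a)\varphi(cb^*)^*$ for all $a,b,c\in A$. 4. $\varphi$ preserves zero-TRO-products if and only if $\varphi(ab)\varphi(c)^*\varphi(de)=\varphi(a)\varphi(d^*cb^*)^*\varphi(e)$ for all $a,b,c,d,e\in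 A$. -/

import Mathlib

/-- A map between C*-algebras preserves zero-products: `ab = 0` implies `φ(a)φ(b) = 0`. -/
def PreservesZeroProducts {A B : Type*} [NonUnitalCStarAlgebra A] [NonUnitalCStarAlgebra B]
    (φ : A → B) : Prop :=
  ∀ a b : A, a * b = 0 → φ a * φ b = 0

/-- A map between C*-algebras preserves range-orthogonality:
`a*b = 0` implies `φ(a)*φ(b) = 0`, the star being the adjoint. -/
def PreservesRangeOrthogonality {A B : Type*} [NonUnitalCStarAlgebra A] [NonUnitalCStarAlgebra B]
    (φ : A → B) : Prop :=
  ∀ a b : A, star a * b = 0 → star (φ a) * φ b = 0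

/-- A map between C*-algebras preserves domain-orthogonality:
`ab* = 0` implies `φ(a)φ(b)* = 0`. -/
def PreservesDomainOrthogonality {A B : Type*} [NonUnitalCStarAlgebra A] [NonUnitalCStarAlgebra B]
    (φ : A → B) : Prop :=
  ∀ a b : A, a * star b = 0 → φ a * star (φ b) = 0

/-- A map between C*-algebras preserves zero-TRO-products:
`ab*c = 0` implies `φ(a)φ(b)*φ(c) = 0`. -/
def PreservesZeroTROProducts {A B : Type*} [NonUnitalCStarAlgebra A] [NonUnitalCStarAlgebra B]
    (φ : A → B) : Prop :=
  ∀ a b c : A, a * star b * c = 0 → φ a * star (φ b) * φ c = 0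

/-!
Let `V` be a bounded bilinear map on a unital C⋆-algebra that vanishes on pairs with zero product.
Given a self-adjoint `h`, the functional calculus turns a partition of unity of the line by tents
centred at the integers into elements `b i` with `∑ b i = 1`, `∑ i • b i = h`, and `b i * b j = 0`
for `2 ≤ |i - j|`. Hence `V h 1 - V 1 h = ∑ (i - j) • V (b i) (b j)` only involves terms with
`|i - j| ≤ 1`. Grouping them by the residues of `i` and `j` modulo `3` leaves nine terms of norm at
most `‖V‖`, so the linear map `h ↦ V h 1 - V 1 h` is bounded independently of `h`, and is therefore
zero. Applying this in the unitization to `(x, y) ↦ V (a * x) (y * c)` gives the identity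
`V (a * b) c = V a (b * c)` without a unit; conversely, that identity along an approximate unit
forces `V a b = 0` whenever `a * b = 0`. The theorem is the case of products of `φ` and
`a ↦ star (φ (star a))`.
-/

open Filter Topology WithConv

section PartitionOfUnity

/-- The tent function: its integer translates form the partition of unity of the line that
reproduces affine functions. -/
def tent (x : ℝ) : ℝ := max 0 (1 - |x|)

lemma continuous_tent : Continuous tent := by
  unfold tent; fun_prop

lemma tent_nonneg (x : ℝ) : 0 ≤ tent x := le_max_left _ _

lemma tent_eq_zero {x : ℝ} (hx : 1 ≤ |x|) : tent x = 0 :=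
  max_eq_left (by linarith)

lemma tent_eq_one_sub_abs {x : ℝ} (hx : |x| ≤ 1) : tent x = 1 - |x| :=
  max_eq_right (by linarith)

lemma tent_sub_mul_tent_sub_eq_zero {i j : ℤ} (hij : 2 ≤ |i - j|) (x : ℝ) :
    tent (x - i) * tent (x - j) = 0 := by
  have h : (2 : ℝ) ≤ |(i : ℝ) - j| := by exact_mod_cast hij
  rw [mul_eq_zero]
  by_contra! hne
  have hi := lt_of_not_ge (mt tent_eq_zero hne.1)
  have hj := lt_of_not_ge (mt tent_eq_zero hne.2)
  grind

lemma sum_mul_tent_sub {x : ℝ} {s : Finset ℤ} (h₀ : ⌊x⌋ ∈ s) (h₁ : ⌊x⌋ + 1 ∈ s) (c : ℤ → ℝ) :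
    ∑ i ∈ s, c i * tent (x - i) =
      c ⌊x⌋ * (1 - Int.fract x) + c (⌊x⌋ + 1) * Int.fract x := by
  have hfract := Int.floor_add_fract x
  have hnonneg := Int.fract_nonneg x
  have hlt := Int.fract_lt_one x
  have hsub : {⌊x⌋, ⌊x⌋ + 1} ⊆ s := by simp [Finset.insert_subset_iff, h₀, h₁]
  have hfloor : tent (x - ⌊x⌋) = 1 - Int.fract x := by
    rw [tent_eq_one_sub_abs] <;> grind
  have hsucc : tent (x - (⌊x⌋ + 1 : ℤ)) = Int.fract x := by
    push_cast
    rw [tent_eq_one_sub_abs] <;> grind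
  rw [← Finset.sum_subset hsub, Finset.sum_pair (by simp), hfloor, hsucc]
  intro i _ hi
  rw [Finset.mem_insert, Finset.mem_singleton, not_or] at hi
  rw [tent_eq_zero, mul_zero]
  rcases lt_or_gt_of_ne hi.1 with h | h
  · have : (i : ℝ) + 1 ≤ ⌊x⌋ := by exact_mod_cast h
    grind
  · have : (⌊x⌋ : ℝ) + 2 ≤ i := by exact_mod_cast (by grind : ⌊x⌋ + 2 ≤ i)
    grind

variable {K : Type*} [TopologicalSpace K]

lemma exists_partitionOfUnity_sum_zsmul_eq [CompactSpace K] (t : C(K, ℝ)) :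
    ∃ (b : ℤ → C(K, ℝ)) (s : Finset ℤ), (∀ i, 0 ≤ b i) ∧
      (∀ i j, 2 ≤ |i - j| → b i * b j = 0) ∧ ∑ i ∈ s, b i = 1 ∧ ∑ i ∈ s, i • b i = t := by
  let b (i : ℤ) : C(K, ℝ) := ⟨fun x ↦ tent (t x - i), continuous_tent.comp (by fun_prop)⟩
  let s : Finset ℤ := Finset.Icc ⌊-‖t‖⌋ (⌊‖t‖⌋ + 1)
  have hs (x : K) : ⌊t x⌋ ∈ s ∧ ⌊t x⌋ + 1 ∈ s := by
    have hle := abs_le.1 (t.norm_coe_le_norm x)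
    have := Int.floor_mono hle.1
    have := Int.floor_mono hle.2
    constructor <;> grind
  have hsum (c : ℤ → ℝ) (x : K) : (∑ i ∈ s, c i • b i) x =
      c ⌊t x⌋ * (1 - Int.fract (t x)) + c (⌊t x⌋ + 1) * Int.fract (t x) := by
    rw [← sum_mul_tent_sub (hs x).1 (hs x).2, ContinuousMap.sum_apply]
    rfl
  refine ⟨b, s, fun i x ↦ tent_nonneg _, fun i j hij ↦ ?_, ?_, ?_⟩
  · ext x
    exact tent_sub_mul_tent_sub_eq_zero hij (t x)
  · ext x
    simpa using hsum 1 x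
  · ext x
    simp only [← Int.cast_smul_eq_zsmul ℝ]
    rw [hsum]
    push_cast
    linarith [Int.floor_add_fract (t x)]

lemma norm_sum_le_one_of_subset [CompactSpace K] {ι : Type*} {b : ι → C(K, ℝ)} (hb : ∀ i, 0 ≤ b i)
    {s u : Finset ι} (hs : ∑ i ∈ s, b i = 1) (hu : u ⊆ s) : ‖∑ i ∈ u, b i‖ ≤ 1 := by
  have hnonneg : 0 ≤ ∑ i ∈ u, b i := Finset.sum_nonneg fun i _ ↦ hb i
  have hle : ∑ i ∈ u, b i ≤ 1 := hs ▸ Finset.sum_le_sum_of_subset_of_nonneg hu fun i _ _ ↦ hb i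
  exact (ContinuousMap.norm_le _ zero_le_one).2 fun x ↦
    (Real.norm_of_nonneg (hnonneg x)).trans_le (hle x)

end PartitionOfUnity

section ResidueSum

/-- The sum of the `b i` with `i ∈ s` in a given residue class modulo `3`; these sums gather a
family in which only neighbouring indices interact into three pieces. -/
def residueSum {M : Type*} [AddCommMonoid M] (b : ℤ → M) (s : Finset ℤ) (r : ZMod 3) : M :=
  ∑ i ∈ s with (Int.cast i : ZMod 3) = r, b i

lemma valMinAbs_intCast_zmod_three {n : ℤ} (hn : |n| < 2) : (n : ZMod 3).valMinAbs = n := by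
  rw [ZMod.valMinAbs_spec]
  grind

lemma sum_prod_residueSum {R M N : Type*} [CommRing R] [AddCommGroup M] [AddCommGroup N]
    [Module R M] [Module R N] (W : M →ₗ[R] M →ₗ[R] N) (b : ℤ → M) (s : Finset ℤ)
    (c : ZMod 3 × ZMod 3 → ℤ) :
    ∑ p, c p • W (residueSum b s p.1) (residueSum b s p.2) =
      ∑ i ∈ s, ∑ j ∈ s, c (i, j) • W (b i) (b j) := by
  have hfiber (r q : ZMod 3) : c (r, q) • W (residueSum b s r) (residueSum b s q) =
      ∑ i ∈ s with (Int.cast i : ZMod 3) = r, ∑ j ∈ s with (Int.cast j : ZMod 3) = q,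
        c (i, j) • W (b i) (b j) := by
    simp only [residueSum, map_sum, LinearMap.sum_apply, Finset.smul_sum]
    rw [Finset.sum_comm]
    refine Finset.sum_congr rfl fun i hi ↦ Finset.sum_congr rfl fun j hj ↦ ?_
    rw [(Finset.mem_filter.1 hi).2, (Finset.mem_filter.1 hj).2]
  simp only [Fintype.sum_prod_type, hfiber]
  calc _ = ∑ r, ∑ i ∈ s with (Int.cast i : ZMod 3) = r,
        ∑ q, ∑ j ∈ s with (Int.cast j : ZMod 3) = q, c (i, j) • W (b i) (b j) :=
      Finset.sum_congr rfl fun r _ ↦ Finset.sum_comm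
    _ = _ := by simp only [Finset.sum_fiberwise]

-- Both `W (b i) (b j)` and its coefficient `i - j` only matter when `|i - j| ≤ 1`, and then
-- `i - j` is determined by the residues of `i` and `j` modulo `3`.
lemma apply_sum_zsmul_sub_apply_sum_zsmul {R M N : Type*} [CommRing R] [AddCommGroup M]
    [AddCommGroup N] [Module R M] [Module R N] (W : M →ₗ[R] M →ₗ[R] N) {b : ℤ → M}
    (hW : ∀ i j, 2 ≤ |i - j| → W (b i) (b j) = 0) (s : Finset ℤ) :
    W (∑ i ∈ s, i • b i) (∑ i ∈ s, b i) - W (∑ i ∈ s, b i) (∑ i ∈ s, i • b i) =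
      ∑ p : ZMod 3 × ZMod 3,
        (p.1 - p.2).valMinAbs • W (residueSum b s p.1) (residueSum b s p.2) := by
  have hcoeff (i j : ℤ) : ((i : ZMod 3) - j).valMinAbs • W (b i) (b j) =
      (i - j) • W (b i) (b j) := by
    rcases lt_or_ge |i - j| 2 with h | h
    · rw [← Int.cast_sub, valMinAbs_intCast_zmod_three h]
    · rw [hW i j h, smul_zero, smul_zero]
  rw [sum_prod_residueSum W b s fun p ↦ (p.1 - p.2).valMinAbs]
  simp only [hcoeff, map_sum, map_zsmul, LinearMap.sum_apply, LinearMap.smul_apply, sub_smul,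
    Finset.smul_sum, Finset.sum_sub_distrib]
  congr 1 <;> exact Finset.sum_comm

end ResidueSum

section UnitalBalanced

variable {A X : Type*} [CStarAlgebra A] [NormedAddCommGroup X] [NormedSpace ℂ X]

lemma exists_partitionOfUnity_of_isSelfAdjoint {h : A} (hh : IsSelfAdjoint h) :
    ∃ (b : ℤ → A) (s : Finset ℤ), (∀ u ⊆ s, ‖∑ i ∈ u, b i‖ ≤ 1) ∧
      (∀ i j, 2 ≤ |i - j| → b i * b j = 0) ∧ ∑ i ∈ s, b i = 1 ∧ ∑ i ∈ s, i • b i = h := by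
  obtain ⟨b, s, hb, hdisj, hsum, hid⟩ :=
    exists_partitionOfUnity_sum_zsmul_eq ((ContinuousMap.id ℝ).restrict (spectrum ℝ h))
  refine ⟨fun i ↦ cfcHom hh (b i), s, fun u hu ↦ ?_, fun i j hij ↦ ?_, ?_, ?_⟩
  · rw [← map_sum, norm_cfcHom h _ hh]
    exact norm_sum_le_one_of_subset hb hsum hu
  · rw [← map_mul, hdisj i j hij, map_zero]
  · rw [← map_sum, hsum, map_one]
  · simp_rw [← map_zsmul, ← map_sum]
    rw [hid, cfcHom_id]

lemma norm_apply_one_sub_one_apply_le_of_isSelfAdjoint (V : A →L[ℂ] A →L[ℂ] X)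
    (hV : ∀ x y, x * y = 0 → V x y = 0) {h : A} (hh : IsSelfAdjoint h) :
    ‖V h 1 - V 1 h‖ ≤ 9 * ‖V‖ := by
  obtain ⟨b, s, hb, hdisj, hone, rfl⟩ := exists_partitionOfUnity_of_isSelfAdjoint hh
  have hres (r : ZMod 3) : ‖residueSum b s r‖ ≤ 1 := hb _ (Finset.filter_subset _ _)
  have hcoeff (r : ZMod 3) : ‖r.valMinAbs‖ ≤ 1 := by
    have : |r.valMinAbs| ≤ 1 := by decide +revert
    exact_mod_cast (Int.norm_eq_abs r.valMinAbs).trans_le (by exact_mod_cast this)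
  have hterm (p : ZMod 3 × ZMod 3) :
      ‖(p.1 - p.2).valMinAbs • V (residueSum b s p.1) (residueSum b s p.2)‖ ≤ ‖V‖ := by
    calc _ ≤ 1 * (‖V‖ * 1 * 1) := by
          refine (norm_zsmul_le _ _).trans ?_
          gcongr
          · exact hcoeff _
          · exact V.le_of_opNorm₂_le_of_le le_rfl (hres _) (hres _)
      _ = ‖V‖ := by ring
  have hsum : V (∑ i ∈ s, i • b i) 1 - V 1 (∑ i ∈ s, i • b i) = ∑ p : ZMod 3 × ZMod 3,
      (p.1 - p.2).valMinAbs • V (residueSum b s p.1) (residueSum b s p.2) := by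
    rw [← hone]
    exact apply_sum_zsmul_sub_apply_sum_zsmul V.toLinearMap₁₂
      (fun i j hij ↦ hV _ _ (hdisj i j hij)) s
  rw [hsum]
  exact (norm_sum_le_of_le _ fun p _ ↦ hterm p).trans_eq (by simp [ZMod.card])

lemma norm_apply_one_sub_one_apply_le (V : A →L[ℂ] A →L[ℂ] X)
    (hV : ∀ x y, x * y = 0 → V x y = 0) (x : A) : ‖V x 1 - V 1 x‖ ≤ 18 * ‖V‖ := by
  have hre := norm_apply_one_sub_one_apply_le_of_isSelfAdjoint V hV (realPart x).2
  have him := norm_apply_one_sub_one_apply_le_of_isSelfAdjoint V hV (imaginaryPart x).2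
  have hsplit : V x 1 - V 1 x = (V (realPart x : A) 1 - V 1 (realPart x : A)) +
      Complex.I • (V (imaginaryPart x : A) 1 - V 1 (imaginaryPart x : A)) := by
    nth_rw 1 2 [← realPart_add_I_smul_imaginaryPart x]
    simp only [map_add, map_smul, add_apply, smul_apply]
    module
  rw [hsplit]
  refine (norm_add_le _ _).trans ?_
  rw [norm_smul, Complex.norm_I, one_mul]
  linarith

lemma eq_zero_of_forall_norm_le {𝕜 E F : Type*} [NontriviallyNormedField 𝕜] [AddCommGroup E]
    [Module 𝕜 E] [NormedAddCommGroup F] [NormedSpace 𝕜 F] (f : E →ₗ[𝕜] F) {M : ℝ}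
    (hf : ∀ x, ‖f x‖ ≤ M) : f = 0 := by
  ext x
  by_contra hne
  obtain ⟨c, hc⟩ := NormedField.exists_lt_norm 𝕜 (M / ‖f x‖)
  rw [div_lt_iff₀ (norm_pos_iff.2 hne), ← norm_smul, ← map_smul] at hc
  exact (hf (c • x)).not_gt hc

theorem apply_one_eq_one_apply (V : A →L[ℂ] A →L[ℂ] X) (hV : ∀ x y, x * y = 0 → V x y = 0)
    (x : A) : V x 1 = V 1 x := by
  have h := eq_zero_of_forall_norm_le (V.flip 1 - V 1).toLinearMap
    (norm_apply_one_sub_one_apply_le V hV)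
  exact sub_eq_zero.1 (LinearMap.congr_fun h x)

end UnitalBalanced

section ZeroProductDetermined

variable {A X : Type*} [NonUnitalCStarAlgebra A] [NormedAddCommGroup X] [NormedSpace ℂ X]

/-- The second projection of the unitization as a continuous linear map; it carries the ideal of
elements with zero scalar part back to `A`. -/
noncomputable def unitizationSnd (A : Type*) [NonUnitalCStarAlgebra A] : Unitization ℂ A →L[ℂ] A :=
  ⟨Unitization.sndHom ℂ ℂ A, Unitization.continuous_snd⟩

lemma inr_unitizationSnd {x : Unitization ℂ A} (hx : x.fst = 0) :
    (unitizationSnd A x : Unitization ℂ A) = x :=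
  Unitization.ext hx.symm rfl

@[simp]
lemma unitizationSnd_inr (a : A) : unitizationSnd A (a : Unitization ℂ A) = a := rfl

lemma apply_mul_eq_apply_mul (V : A →L[ℂ] A →L[ℂ] X) (hV : ∀ x y, x * y = 0 → V x y = 0)
    (a b c : A) : V (a * b) c = V a (b * c) := by
  let L : Unitization ℂ A →L[ℂ] A :=
    unitizationSnd A ∘L ContinuousLinearMap.mul ℂ _ (a : Unitization ℂ A)
  let R : Unitization ℂ A →L[ℂ] A :=
    unitizationSnd A ∘L (ContinuousLinearMap.mul ℂ _).flip (c : Unitization ℂ A)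
  have hL (x : Unitization ℂ A) : (L x : Unitization ℂ A) = a * x := inr_unitizationSnd (by simp)
  have hR (x : Unitization ℂ A) : (R x : Unitization ℂ A) = x * c := inr_unitizationSnd (by simp)
  have hLR (x y : Unitization ℂ A) (hxy : x * y = 0) : L x * R y = 0 := by
    apply Unitization.inr_injective (R := ℂ)
    rw [Unitization.inr_mul, hL, hR, mul_assoc, ← mul_assoc x, hxy, zero_mul, mul_zero,
      Unitization.inr_zero]
  have key := apply_one_eq_one_apply (V.bilinearComp L R)
    (fun x y hxy ↦ hV _ _ (hLR x y hxy)) (b : Unitization ℂ A)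
  simpa [L, R, ← Unitization.inr_mul] using key

variable (A) in
lemma exists_isApproximateUnit : ∃ l : Filter A, l.IsApproximateUnit := by
  let _ := CStarAlgebra.spectralOrder A
  let _ := CStarAlgebra.spectralOrderedRing A
  exact ⟨_, (CStarAlgebra.increasingApproximateUnit A).toIsApproximateUnit⟩

theorem forall_mul_eq_zero_iff_apply_mul_eq (V : A →L[ℂ] A →L[ℂ] X) :
    (∀ a b, a * b = 0 → V a b = 0) ↔ ∀ a b c, V (a * b) c = V a (b * c) := by
  refine ⟨apply_mul_eq_apply_mul V, fun h a b hab ↦ ?_⟩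
  obtain ⟨l, hl⟩ := exists_isApproximateUnit A
  have := hl.neBot
  have hlim : Tendsto (fun e ↦ V a (b * e)) l (𝓝 (V a b)) :=
    ((V a).continuous.tendsto b).comp (hl.tendsto_mul_left b)
  refine tendsto_nhds_unique hlim ?_
  simp [← h, hab]

theorem forall_mul_mul_eq_zero_iff_apply_mul_eq (T : A →L[ℂ] A →L[ℂ] A →L[ℂ] X) :
    (∀ a b c, a * b * c = 0 → T a b c = 0) ↔
      ∀ a b c d e, T (a * b) c (d * e) = T a (b * c * d) e := by
  constructor
  · intro hT a b c d e
    have hleft (z : A) : T (a * b) c z = T a (b * c) z :=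
      apply_mul_eq_apply_mul (ContinuousLinearMap.compL ℂ A (A →L[ℂ] X) X (.apply ℂ X z) ∘L T)
        (fun x y hxy ↦ hT x y z (by rw [hxy, zero_mul])) a b c
    have hright : T a (b * c * d) e = T a (b * c) (d * e) :=
      apply_mul_eq_apply_mul (T a) (fun y z hyz ↦ hT a y z (by rw [mul_assoc, hyz, mul_zero]))
        (b * c) d e
    rw [hleft, hright]
  · intro h a b c habc
    obtain ⟨l, hl⟩ := exists_isApproximateUnit A
    have := hl.neBot
    have hcont : Continuous fun p : A × A ↦ T p.1 b p.2 := by fun_prop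
    have hlim : Tendsto (fun e ↦ T (e * a) b (c * e)) l (𝓝 (T a b c)) :=
      (hcont.tendsto (a, c)).comp (f := fun e ↦ (e * a, c * e))
        ((hl.tendsto_mul_right a).prodMk_nhds (hl.tendsto_mul_left c))
    refine tendsto_nhds_unique hlim ?_
    simp [h, habc]

end ZeroProductDetermined

section Preservers

variable {A B : Type*} [NonUnitalCStarAlgebra A] [NonUnitalNormedRing B] [NormedSpace ℂ B]
  [IsScalarTower ℂ B B] [SMulCommClass ℂ B B]

lemma forall_mul_eq_zero_iff_map_mul (f g : A →L[ℂ] B) :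
    (∀ a b, a * b = 0 → f a * g b = 0) ↔ ∀ a b c, f (a * b) * g c = f a * g (b * c) :=
  forall_mul_eq_zero_iff_apply_mul_eq ((ContinuousLinearMap.mul ℂ B).bilinearComp f g)

lemma forall_mul_mul_eq_zero_iff_map_mul (f g k : A →L[ℂ] B) :
    (∀ a b c, a * b * c = 0 → f a * g b * k c = 0) ↔
      ∀ a b c d e, f (a * b) * g c * k (d * e) = f a * g (b * c * d) * k e :=
  let mulMap := ContinuousLinearMap.mul ℂ B
  forall_mul_mul_eq_zero_iff_apply_mul_eq
    (ContinuousLinearMap.compL ℂ A B (A →L[ℂ] B) (mulMap.bilinearComp (.id ℂ B) k) ∘L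
      mulMap.bilinearComp f g)

variable [StarRing B] [StarModule ℂ B] [ContinuousStar B]

theorem theorem2p2_general (φ : A →L[ℂ] B) :
    ((∀ a b : A, a * b = 0 → φ a * φ b = 0) ↔
      ∀ a b c : A, φ (a * b) * φ c = φ a * φ (b * c)) ∧
    ((∀ a b : A, star a * b = 0 → star (φ a) * φ b = 0) ↔
      ∀ a b c : A, star (φ (star b * a)) * φ c = star (φ a) * φ (b * c)) ∧
    ((∀ a b : A, a * star b = 0 → φ a * star (φ b) = 0) ↔
      ∀ a b c : A, φ (a * b) * star (φ c) = φ a * star (φ (c * star b))) ∧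
    ((∀ a b c : A, a * star b * c = 0 → φ a * star (φ b) * φ c = 0) ↔
      ∀ a b c d e : A, φ (a * b) * star (φ c) * φ (d * e) =
        φ a * star (φ (star d * c * star b)) * φ e) := by
  let ψ : A →L[ℂ] B := (star (toConv φ)).ofConv
  have hψ (a : A) : ψ a = star (φ (star a)) := by simp [ψ]
  have hstar : Function.Surjective (star : A → A) := star_involutive.surjective
  refine ⟨forall_mul_eq_zero_iff_map_mul φ φ, ?_, ?_, ?_⟩
  · refine .trans (.symm ?_) ((forall_mul_eq_zero_iff_map_mul ψ φ).trans ?_) <;>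
      exact hstar.forall.trans (by simp [hψ])
  · refine .trans (forall_congr' fun a ↦ .symm ?_)
      ((forall_mul_eq_zero_iff_map_mul φ ψ).trans (forall₂_congr fun a b ↦ ?_)) <;>
      exact hstar.forall.trans (by simp [hψ])
  · refine .trans (forall_congr' fun a ↦ .symm ?_)
      ((forall_mul_mul_eq_zero_iff_map_mul φ ψ φ).trans (forall₂_congr fun a b ↦ ?_)) <;>
      exact hstar.forall.trans (by simp [hψ, mul_assoc])

end Preservers

theorem theorem2p2 {A B : Type*} [NonUnitalCStarAlgebra A] [NonUnitalCStarAlgebra B]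
    (φ : A →L[ℂ] B) :
    (PreservesZeroProducts φ ↔
      ∀ a b c : A, φ (a * b) * φ c = φ a * φ (b * c)) ∧
    (PreservesRangeOrthogonality φ ↔
      ∀ a b c : A, star (φ (star b * a)) * φ c = star (φ a) * φ (b * c)) ∧
    (PreservesDomainOrthogonality φ ↔
      ∀ a b c : A, φ (a * b) * star (φ c) = φ a * star (φ (c * star b))) ∧
    (PreservesZeroTROProducts φ ↔
      ∀ a b c d e : A, φ (a * b) * star (φ c) * φ (d * e) =
        φ a * star (φ (star d * c * star b)) * φ e) :=
  theorem2p2_general φ
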